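/- Let $\lambda\in(0,\tfrac12)$. There is a constant $N_\lambda$, depending only on $\lambda$, such that the following holds for all $n\ge N_\lambda$. Let $G$ be a bipartite graph with parts $X=\{x_1,\dots,x_n\}$, $Y=\{y_1,\dots,y_n\}$ in which every vertex has degree at least $(\tfrac12+\lambda)n$, let $A$ be its $n\times n$ adjacency matrix, and let $Q^A=D_\alpha A D_\beta$ ($D_\alpha,D_\beta$ diagonal) be its doubly stochastic scaling. Perfect matchings $M$ of $G$ are identified with permutations ($x_i$ is matched to $y_{M(i)}$); $\nu$ is the uniform distribution on them, and $P_{ij}=\nu(M(i)=j)$. For a permutation $\pi$ of $[n]$ and a nonnegative matrix $Q$, let $$p_{\pi,Q}(M)=\prod_{i=1}^n \frac{Q_{\pi(i),M(\pi(i))}}{\sum_{j\in N_i}Q_{\pi(i),j}},$$ where $N_i$ is the set of $j$ for which some perfect matching of $G$ contains the edges $x_{\pi(l)}y_{M(\pi(l))}$, $l<i$, and the edge $x_{\pi(i)}y_j$; this is the probability that sequential importance sampling with row order $\pi$ and weights $Q$ produces $M$. Write $j\ge_\pi k$ if $\pi(j)\ge\pi(k)$, and set $$F(Q)=-\sum_{t,k=1}^n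 P_{tk}\log Q_{tk}+\sum_{t,k=1}^n P_{tk}\,\mathbb E_\pi\log\Big(\sum_{j\ge_\pi k}Q_{tj}\Big),$$ where $\pi$ is a uniformly random permutation, terms with $P_{tk}=0$ are $0$, and $F(Q)=+\infty$ if $Q_{tk}=0$ for some $(t,k)$ with $P_{tk}>0$. Let $r_i=n\max_j Q^A_{ij}$, and let $\mathcal Q$ be the set of row-stochastic matrices $Q$ such that $Q_{ij}\le r_i/n$ for all $i,j$, and $Q_{ij}>0$ only if $Q^A_{ij}>0$. Then: 1. There is a matrix $Q^*\in\mathcal Q$ such that in each row $i$ all nonzero entries of $Q^*$, except at most one, are equal to $r_i/n$, and $$F(Q^*)\ \ge\ \mathbb E_{M\sim\nu,\ \pi}\big(-\log p_{\pi,Q^A}(M)\big),$$ where $\pi$ is a uniformly random permutation independent of $M$. 2. For every $Q\in\mathcal Q$, every row $i$ and all $j_1\ne j_2$ such that $x_iy_{j_1}$ and $x_iy_{j_2}$ are edges of $G$, put $s=Q_{ij_1}+Q_{ij_2}$. Then the $(-\infty,+\infty]$-valued function of $x\in[0,s]$, obtained by evaluating $F$ at the matrix $Q$ with the entries $Q_{ij_1},Q_{ij_2}$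 replaced by $x$ and $s-x$, is convex on $[0,s]$. -/

import Mathlib

namespace SIS

open Finset

noncomputable section

open scoped Classical in
/-- The adjacency matrix of the bipartite graph on the parts `X = Y = Fin n` whose edges are the
pairs `(x_i, y_j)` with `E i j`. -/
def adjMatrix {n : ℕ} (E : Fin n → Fin n → Prop) : Matrix (Fin n) (Fin n) ℝ :=
  Matrix.of fun i j => if E i j then 1 else 0

open scoped Classical in
/-- A bipartite graph with parts of size `n` is `lam`-dense if every vertex (on either side) has
degree at least `(1/2 + lam) n`. -/
def IsDense {n : ℕ} (lam : ℝ) (E : Fin n → Fin n → Prop) : Prop :=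
  (∀ i, (1 / 2 + lam) * (n : ℝ) ≤ (#{j | E i j} : ℝ)) ∧
  (∀ j, (1 / 2 + lam) * (n : ℝ) ≤ (#{i | E i j} : ℝ))

open scoped Classical in
/-- The set of perfect matchings; the permutation `σ` is the matching `x_i ↦ y_{σ i}`. -/
def perfectMatchings {n : ℕ} (E : Fin n → Fin n → Prop) : Finset (Equiv.Perm (Fin n)) :=
  {σ | ∀ i, E i (σ i)}

/-- The matrix `P` of matching marginals: `P i j` is the probability that the edge `(x_i, y_j)`
belongs to a uniformly random perfect matching. -/
def marginal {n : ℕ} (E : Fin n → Fin n → Prop) : Matrix (Fin n) (Fin n) ℝ :=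
  Matrix.of fun i j =>
    (#{σ ∈ perfectMatchings E | σ i = j} : ℝ) / (#(perfectMatchings E) : ℝ)

/-- `QA` is the doubly stochastic scaling `D_α A D_β` of the matrix `A`. -/
def IsScaling {n : ℕ} (A QA : Matrix (Fin n) (Fin n) ℝ) : Prop :=
  QA ∈ doublyStochastic ℝ (Fin n) ∧
    ∃ α β : Fin n → ℝ, QA = Matrix.diagonal α * A * Matrix.diagonal β

/-- When the rows are processed in the order `π 0, π 1, …` and the rows before step `i` have been
matched as in `σ`, these are the extendable neighbours of `x_{π i}`: the `j` such that some
perfect matching contains the partial matching constructed so far and the edge `(x_{π i}, y_j)`. -/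
def extendable {n : ℕ} (E : Fin n → Fin n → Prop) (π σ : Equiv.Perm (Fin n)) (i : Fin n) :
    Finset (Fin n) :=
  {j | ∃ τ ∈ perfectMatchings E, (∀ i' < i, τ (π i') = σ (π i')) ∧ τ (π i) = j}

/-- The probability `p_{π,Q}(σ)` that sequential importance sampling with row order `π` and weight
matrix `Q` generates the perfect matching `σ`: at step `i` the vertex `x_{π i}` is matched to one of
its extendable neighbours, chosen with probability proportional to row `π i` of `Q`. -/
def sisProb {n : ℕ} (E : Fin n → Fin n → Prop) (Q : Matrix (Fin n) (Fin n) ℝ)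
    (π σ : Equiv.Perm (Fin n)) : ℝ :=
  ∏ i, Q (π i) (σ (π i)) / ∑ j ∈ extendable E π σ i, Q (π i) j

/-- `E[-log p_{π,Q}(M)]` for `M` a uniformly random perfect matching and, independently, `π` a
uniformly random permutation. -/
def expectedNegLog {n : ℕ} (E : Fin n → Fin n → Prop) (Q : Matrix (Fin n) (Fin n) ℝ) : ℝ :=
  (∑ σ ∈ perfectMatchings E, (∑ π : Equiv.Perm (Fin n), -Real.log (sisProb E Q π σ)) /
    (n.factorial : ℝ)) / (#(perfectMatchings E) : ℝ)

/-- `E_π log (∑_{j ≥_π k} Q t j)` for a uniformly random permutation `π`, where `j ≥_π k` means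
`π j ≥ π k`. -/
def expectedLogTail {n : ℕ} (Q : Matrix (Fin n) (Fin n) ℝ) (t k : Fin n) : ℝ :=
  (∑ π : Equiv.Perm (Fin n), Real.log (∑ j with π k ≤ π j, Q t j)) / (n.factorial : ℝ)

open scoped Classical in
/-- The functional `-∑_e P_e log Q_e + ∑_{t,k} P_{tk} E_π log (∑_{j ≥_π k} Q_{tj})`, for a
nonnegative matrix `Q`, with values in `(-∞, +∞]`.

If `Q_e ≠ 0` whenever `P_e ≠ 0`, then every logarithm with a nonzero coefficient has a positive
argument, and the value is the displayed real number (terms with `P_e = 0` vanish).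
If `Q_{tk} = 0` for some `P_{tk} ≠ 0`, then `-P_{tk} log Q_{tk} = +∞` by the convention
`-log 0 = +∞`, and the value is `+∞`. -/
def upperBound {n : ℕ} (P Q : Matrix (Fin n) (Fin n) ℝ) : EReal :=
  if ∀ t k, P t k ≠ 0 → Q t k ≠ 0 then
    ((-(∑ t, ∑ k, P t k * Real.log (Q t k)) + ∑ t, ∑ k, P t k * expectedLogTail Q t k : ℝ) : EReal)
  else ⊤

/-- `r_i = n * max_j QA i j`. -/
def rowMax {n : ℕ} (QA : Matrix (Fin n) (Fin n) ℝ) (i : Fin n) : ℝ := (n : ℝ) * ⨆ j, QA i j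

/-- The class of row-stochastic matrices whose entries in row `i` are at most `r_i / n` and whose
nonzero entries are at positions of nonzero entries of `QA`. -/
def classQ {n : ℕ} (QA : Matrix (Fin n) (Fin n) ℝ) : Set (Matrix (Fin n) (Fin n) ℝ) :=
  {Q | Q ∈ Matrix.rowStochastic ℝ (Fin n) ∧ (∀ i j, Q i j ≤ rowMax QA i / (n : ℝ)) ∧
    ∀ i j, 0 < Q i j → 0 < QA i j}

/-- The matrix obtained from `Q` by replacing the entries `(i, j₁)` and `(i, j₂)` (where `j₁ ≠ j₂`)
by `x` and `Q i j₁ + Q i j₂ - x`, so that the row sums do not change. -/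
def exchange {n : ℕ} (Q : Matrix (Fin n) (Fin n) ℝ) (i j₁ j₂ : Fin n) (x : ℝ) :
    Matrix (Fin n) (Fin n) ℝ :=
  Matrix.of fun a b =>
    if a = i ∧ b = j₁ then x else if a = i ∧ b = j₂ then Q i j₁ + Q i j₂ - x else Q a b

/-- Convexity on a set `s` of reals of an extended-real function that does not take the value `-∞`
(with `0 * (+∞) = 0`). -/
def ConvexOnEReal (s : Set ℝ) (g : ℝ → EReal) : Prop :=
  ∀ x ∈ s, ∀ y ∈ s, ∀ θ : ℝ, 0 ≤ θ → θ ≤ 1 →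
    g (θ * x + (1 - θ) * y) ≤ (θ : EReal) * g x + ((1 - θ : ℝ) : EReal) * g y

end

end SIS

namespace SIS

open Finset

/-! ### Ranks in a uniformly random permutation -/

/-! Everything rests on convexity of `upperBound` along an exchange of mass between two entries `x`
and `s - x` of one row `i`. The terms `-P log x` and `-P log (s - x)` are convex. The logarithm of a
tail sum spoils this only when the tail contains exactly one of the two columns, where it is `log (x
+ R)` with `R` the rest of the tail. Comparing second derivatives, `log (x + R) - c log x` is convex
on `(0, s)` once `c ≥ (s / (s + R)) ^ 2`. So it suffices that the total compensating weight,
averaged over `π` and over `k` with weights `P i k`, is at most `P i j₁`, and symmetrically for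
`j₂`.

For `k = j₁` the weight is nonzero only if `j₂` precedes `j₁`, an event of probability 1/2, so this
term costs at most `P i j₁ / 2`. For `k ≠ j₁`, density bounds the entries of the scaling, hence of
row `i`, by `1 / (2 lam n)`. Thus a linear number of entries are at least `1 / (2 n)`, `R` grows
linearly in the number of these after `k`, and the weight decays as the inverse square of that
number. Ranks in a random permutation are uniform, so its mean is of order `log n / n ^ 2`, below
`lam / (4 n)` for large `n`. A switching argument gives `P i j₁ ≥ lam / (2 n)`, so this too costs at
most `P i j₁ / 2`.

For the extremal matrix, enlarging each extendable set to all columns not yet used bounds the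
expected negative log-probability of the scaling by `upperBound` at the scaling. A function convex
along exchanges does not decrease when some pair of fractional entries of a row is pushed to a
suitable end of its admissible range. Each push removes a fractional entry, so the process stops at
a matrix of the required shape. -/

theorem sum_rank_eq_sum_range {n : ℕ} (π : Equiv.Perm (Fin n)) (T : Finset (Fin n)) (h : ℕ → ℝ) :
    ∑ k ∈ T, h #{j ∈ T | π k < π j} = ∑ r ∈ range #T, h r := by
  have hlt : ∀ a ∈ T, ∀ b ∈ T, π a < π b → #{j ∈ T | π b < π j} < #{j ∈ T | π a < π j} := by
    intro a _ b hb hab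
    apply card_lt_card
    refine ⟨fun j hj => ?_, fun hsub => ?_⟩
    · rw [mem_filter] at hj ⊢
      exact ⟨hj.1, hab.trans hj.2⟩
    · have := hsub (mem_filter.2 ⟨hb, hab⟩)
      exact lt_irrefl _ (mem_filter.1 this).2
  have hinj : Set.InjOn (fun k => #{j ∈ T | π k < π j}) T := by
    intro a ha b hb hab
    rcases lt_trichotomy (π a) (π b) with h1 | h1 | h1
    · exact absurd hab (hlt a ha b hb h1).ne'
    · exact π.injective h1
    · exact absurd hab (hlt b hb a ha h1).ne
  have himg : T.image (fun k => #{j ∈ T | π k < π j}) = range #T := by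
    apply eq_of_subset_of_card_le
    · intro r hr
      obtain ⟨k, hk, rfl⟩ := mem_image.1 hr
      rw [mem_range]
      exact card_lt_card (filter_ssubset.2 ⟨k, hk, lt_irrefl _⟩)
    · rw [card_range, card_image_of_injOn hinj]
  rw [← himg, sum_image hinj]

theorem card_above_mul_swap {n : ℕ} (π : Equiv.Perm (Fin n)) {T : Finset (Fin n)} {a b : Fin n}
    (ha : a ∈ T) (hb : b ∈ T) (c : Fin n) :
    #{j ∈ T | π c < (π * Equiv.swap a b) j} = #{j ∈ T | π c < π j} := by
  have hT : ∀ j ∈ T, Equiv.swap a b j ∈ T := by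
    intro j hj
    rw [Equiv.swap_apply_def]
    split_ifs <;> assumption
  refine card_bij' (fun j _ => Equiv.swap a b j) (fun j _ => Equiv.swap a b j) ?_ ?_ ?_ ?_
  · intro j hj
    rw [mem_filter] at hj ⊢
    exact ⟨hT j hj.1, hj.2⟩
  · intro j hj
    rw [mem_filter] at hj ⊢
    exact ⟨hT j hj.1, by simpa using hj.2⟩
  · intro j _; simp
  · intro j _; simp

/-- The rank of `k` within `T` is uniform: composing with transpositions makes every element of `T`
contribute equally, and for each fixed `π` the ranks of the elements of `T` run once through `0, …,
#T - 1`. -/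
theorem sum_perm_rank {n : ℕ} {T : Finset (Fin n)} {k : Fin n} (hk : k ∈ T) (h : ℕ → ℝ) :
    ∑ π : Equiv.Perm (Fin n), h #{j ∈ T | π k < π j} =
      n.factorial * ((∑ r ∈ range #T, h r) / #T) := by
  have hsym : ∀ a ∈ T, ∑ π : Equiv.Perm (Fin n), h #{j ∈ T | π a < π j} =
      ∑ π : Equiv.Perm (Fin n), h #{j ∈ T | π k < π j} := by
    intro a ha
    refine Fintype.sum_equiv (Equiv.mulRight (Equiv.swap a k)) _ _ fun π => ?_
    have := card_above_mul_swap π ha hk a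
    change h _ = h #{j ∈ T | (π * Equiv.swap a k) k < (π * Equiv.swap a k) j}
    rw [show (π * Equiv.swap a k) k = π a by simp, this]
  have hT : (#T : ℝ) ≠ 0 := by
    exact_mod_cast (card_pos.2 ⟨k, hk⟩).ne'
  have h1 : ∑ a ∈ T, ∑ π : Equiv.Perm (Fin n), h #{j ∈ T | π a < π j} =
      #T * ∑ π : Equiv.Perm (Fin n), h #{j ∈ T | π k < π j} := by
    rw [sum_congr rfl hsym, sum_const, nsmul_eq_mul]
  rw [sum_comm, sum_congr rfl fun π _ => sum_rank_eq_sum_range π T h, sum_const, nsmul_eq_mul,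
    card_univ, Fintype.card_perm, Fintype.card_fin] at h1
  field_simp
  linarith

/-- By symmetry `j` can be averaged over `T`. Summing the indicator over `j` cancels one factor of
the square, and the remaining inverse is a function of the rank of `k` in `insert k T`, which is
uniform. -/
theorem sum_perm_above_inv_sq {n : ℕ} {T : Finset (Fin n)} {j k : Fin n} (hj : j ∈ T)
    (hk : k ∉ T) :
    ∑ π : Equiv.Perm (Fin n), (if π k < π j then ((#{l ∈ T | π k < π l} : ℝ) ^ 2)⁻¹ else 0) =
      n.factorial * ((∑ r ∈ range (#T + 1), (r : ℝ)⁻¹) / (#T + 1 : ℕ)) / #T := by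
  have hsym : ∀ a ∈ T,
      ∑ π : Equiv.Perm (Fin n), (if π k < π a then ((#{l ∈ T | π k < π l} : ℝ) ^ 2)⁻¹ else 0) =
      ∑ π : Equiv.Perm (Fin n),
        (if π k < π j then ((#{l ∈ T | π k < π l} : ℝ) ^ 2)⁻¹ else 0) := by
    intro a ha
    refine Fintype.sum_equiv (Equiv.mulRight (Equiv.swap a j)) _ _ fun π => ?_
    have hka : k ≠ a := fun h => hk (h ▸ ha)
    have hkj : k ≠ j := fun h => hk (h ▸ hj)
    have hkk : (π * Equiv.swap a j) k = π k := by
      simp [Equiv.swap_apply_of_ne_of_ne hka hkj]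
    change _ = if (π * Equiv.swap a j) k < (π * Equiv.swap a j) j then
      ((#{l ∈ T | (π * Equiv.swap a j) k < (π * Equiv.swap a j) l} : ℝ) ^ 2)⁻¹ else 0
    rw [hkk, card_above_mul_swap π ha hj k, show (π * Equiv.swap a j) j = π a by simp]
  have hT : (#T : ℝ) ≠ 0 := by
    exact_mod_cast (card_pos.2 ⟨j, hj⟩).ne'
  have h1 := sum_congr (rfl : T = T) hsym
  rw [sum_const, nsmul_eq_mul, sum_comm] at h1
  have h2 : ∀ π : Equiv.Perm (Fin n),
      ∑ a ∈ T, (if π k < π a then ((#{l ∈ T | π k < π l} : ℝ) ^ 2)⁻¹ else 0) =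
      (fun r : ℕ => (r : ℝ)⁻¹) #{l ∈ insert k T | π k < π l} := by
    intro π
    rw [filter_insert, if_neg (lt_irrefl _), ← sum_filter, sum_const, nsmul_eq_mul]
    -- If nothing in `T` lies above `k`, both sides vanish because `0⁻¹ = 0`; hence the harmless `r
    -- = 0` term in the final sum.
    by_cases h0 : (#{l ∈ T | π k < π l} : ℝ) = 0
    · simp [h0]
    · field_simp
  rw [sum_congr rfl fun π _ => h2 π, sum_perm_rank (mem_insert_self k T) (fun r : ℕ => (r : ℝ)⁻¹),
    card_insert_of_notMem hk] at h1
  rw [eq_div_iff hT, mul_comm, ← h1]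

/-! ### Convexity of combinations of logarithms -/

/-- The second derivative is `c / x ^ 2 - 1 / (x + R) ^ 2`, nonnegative when `(x / (x + R)) ^ 2 ≤
c`; the left side increases with `x`, so `x = s` is the worst case. -/
theorem convexOn_log_add_sub_mul_log {s R c : ℝ} (hR : 0 ≤ R) (hc : (s / (s + R)) ^ 2 ≤ c) :
    ConvexOn ℝ (Set.Ioo 0 s) fun x => Real.log (x + R) - c * Real.log x := by
  refine convexOn_of_hasDerivWithinAt2_nonneg (f' := fun x => (x + R)⁻¹ - c * x⁻¹)
    (f'' := fun x => -((x + R) ^ 2)⁻¹ + c * (x ^ 2)⁻¹) (convex_Ioo 0 s) ?_ ?_ ?_ ?_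
  · refine ContinuousOn.sub (ContinuousOn.log (by fun_prop) fun x hx => ?_)
      (ContinuousOn.mul (by fun_prop) (ContinuousOn.log (by fun_prop) fun x hx => ?_))
    · have := hx.1; positivity
    · exact hx.1.ne'
  · intro x hx
    rw [interior_Ioo] at hx ⊢
    have h0 : x + R ≠ 0 := by have := hx.1; positivity
    have h1 := ((hasDerivAt_id x).add_const R).log h0
    have h2 := (Real.hasDerivAt_log hx.1.ne').const_mul c
    have h3 := (h1.sub h2).hasDerivWithinAt (s := Set.Ioo 0 s)
    refine h3.congr_deriv ?_
    simp
  · intro x hx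
    rw [interior_Ioo] at hx ⊢
    have h0 : x + R ≠ 0 := by have := hx.1; positivity
    have h1 := ((hasDerivAt_id x).add_const R).inv h0
    have h2 := (hasDerivAt_inv hx.1.ne').const_mul c
    have h3 := (h1.sub h2).hasDerivWithinAt (s := Set.Ioo 0 s)
    refine (h3.congr_deriv ?_)
    simp only [id]
    field_simp
    ring
  · intro x hx
    rw [interior_Ioo] at hx
    have hx0 := hx.1
    have hs : 0 < s := hx.1.trans hx.2
    have h1 : x / (x + R) ≤ s / (s + R) := by
      rw [div_le_div_iff₀ (by positivity) (by positivity)]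
      nlinarith [hx.2]
    have h2 : (x / (x + R)) ^ 2 ≤ c := (pow_le_pow_left₀ (by positivity) h1 2).trans hc
    have h3 : ((x + R) ^ 2)⁻¹ = (x / (x + R)) ^ 2 * (x ^ 2)⁻¹ := by field_simp
    rw [h3]
    nlinarith [mul_le_mul_of_nonneg_right h2 (by positivity : (0 : ℝ) ≤ (x ^ 2)⁻¹)]

/-- Reflection of the interval `(0, s)` preserves convexity. -/
theorem convexOn_comp_sub {s : ℝ} {f : ℝ → ℝ} (hf : ConvexOn ℝ (Set.Ioo 0 s) f) :
    ConvexOn ℝ (Set.Ioo 0 s) fun x => f (s - x) := by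
  refine ⟨convex_Ioo 0 s, fun x hx y hy a b ha hb hab => ?_⟩
  have hx' : s - x ∈ Set.Ioo 0 s := ⟨by linarith [hx.2], by linarith [hx.1]⟩
  have hy' : s - y ∈ Set.Ioo 0 s := ⟨by linarith [hy.2], by linarith [hy.1]⟩
  have := hf.2 hx' hy' ha hb hab
  convert this using 2
  simp only [smul_eq_mul]
  linear_combination (-s) * hab

/-! ### Entries of the doubly stochastic scaling -/

theorem IsScaling.apply {n : ℕ} {E : Fin n → Fin n → Prop} {QA : Matrix (Fin n) (Fin n) ℝ}
    (h : IsScaling (adjMatrix E) QA) :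
    ∃ α β : Fin n → ℝ, (∀ i j, E i j → QA i j = α i * β j) ∧ ∀ i j, ¬ E i j → QA i j = 0 := by
  obtain ⟨α, β, rfl⟩ := h.2
  refine ⟨α, β, fun i j hij => ?_, fun i j hij => ?_⟩ <;>
    simp [Matrix.mul_diagonal, Matrix.diagonal_mul, adjMatrix, hij]

/-- The rows in `S` carry mass `#S`, and the columns outside `T` can absorb at most `n - #T` of it.
-/
theorem card_add_card_sub_le_sum {n : ℕ} {M : Matrix (Fin n) (Fin n) ℝ}
    (hM : M ∈ doublyStochastic ℝ (Fin n)) (S T : Finset (Fin n)) :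
    (#S : ℝ) + #T - n ≤ ∑ l ∈ S, ∑ k ∈ T, M l k := by
  have h1 : ∀ l, ∑ k ∈ T, M l k = 1 - ∑ k ∈ Tᶜ, M l k := by
    intro l
    rw [← sum_row_of_mem_doublyStochastic hM l, ← sum_add_sum_compl T]
    ring
  have h2 : ∑ l ∈ S, ∑ k ∈ Tᶜ, M l k ≤ (n : ℝ) - #T := by
    calc ∑ l ∈ S, ∑ k ∈ Tᶜ, M l k ≤ ∑ l, ∑ k ∈ Tᶜ, M l k :=
          sum_le_sum_of_subset_of_nonneg (subset_univ _) fun l _ _ =>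
            sum_nonneg fun k _ => nonneg_of_mem_doublyStochastic hM
      _ = ∑ k ∈ Tᶜ, (1 : ℝ) :=
          (sum_comm (f := fun l k => M l k)).trans
            (sum_congr rfl fun k _ => sum_col_of_mem_doublyStochastic hM k)
      _ = (n : ℝ) - #T := by
          rw [sum_const, nsmul_eq_mul, mul_one, card_compl, Fintype.card_fin,
            Nat.cast_sub (by simpa using card_le_univ T)]
  rw [sum_congr rfl fun l _ => h1 l, sum_sub_distrib, sum_const, nsmul_eq_mul, mul_one]
  linarith

/-- The product form `α i * β j` gives `QA i j * QA l k = QA l j * QA i k` when all four pairs are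
edges. Summing over neighbours `l` of `j` and `k` of `i` bounds `QA i j` times the mass of that
block by a product of partial column and row sums, at most 1; density makes the block mass at least
`2 * lam * n`. -/
theorem scaling_apply_mul_le_one {n : ℕ} {lam : ℝ} {E : Fin n → Fin n → Prop}
    {QA : Matrix (Fin n) (Fin n) ℝ} (hE : IsDense lam E)
    (h : IsScaling (adjMatrix E) QA) (i j : Fin n) : QA i j * (2 * lam * n) ≤ 1 := by
  classical
  obtain ⟨α, β, h1, h0⟩ := h.apply
  have hnn : ∀ a b, 0 ≤ QA a b := fun a b => nonneg_of_mem_doublyStochastic h.1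
  by_cases hij : E i j
  swap
  · simp [h0 i j hij]
  set S : Finset (Fin n) := {l | E l j} with hS
  set T : Finset (Fin n) := {k | E i k} with hT
  have hSc : (1 / 2 + lam) * (n : ℝ) ≤ #S := by convert hE.2 j
  have hTc : (1 / 2 + lam) * (n : ℝ) ≤ #T := by convert hE.1 i
  have hmass := card_add_card_sub_le_sum h.1 S T
  have hterm : ∀ l ∈ S, ∀ k ∈ T, QA i j * QA l k ≤ QA l j * QA i k := by
    intro l hl k hk
    have hl' : E l j := by simpa [hS] using hl
    have hk' : E i k := by simpa [hT] using hk
    by_cases hlk : E l k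
    · rw [h1 i j hij, h1 l k hlk, h1 l j hl', h1 i k hk']
      exact le_of_eq (by ring)
    · rw [h0 l k hlk, mul_zero]
      exact mul_nonneg (hnn _ _) (hnn _ _)
  have hrow : ∑ k ∈ T, QA i k ≤ 1 := by
    rw [← sum_row_of_mem_doublyStochastic h.1 i]
    exact sum_le_sum_of_subset_of_nonneg (subset_univ _) fun _ _ _ => hnn _ _
  have hcol : ∑ l ∈ S, QA l j ≤ 1 := by
    rw [← sum_col_of_mem_doublyStochastic h.1 j]
    exact sum_le_sum_of_subset_of_nonneg (subset_univ _) fun _ _ _ => hnn _ _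
  calc QA i j * (2 * lam * n) ≤ QA i j * ∑ l ∈ S, ∑ k ∈ T, QA l k :=
        mul_le_mul_of_nonneg_left (by linarith) (hnn i j)
    _ = ∑ l ∈ S, ∑ k ∈ T, QA i j * QA l k := by simp_rw [mul_sum]
    _ ≤ ∑ l ∈ S, ∑ k ∈ T, QA l j * QA i k :=
        sum_le_sum fun l hl => sum_le_sum fun k hk => hterm l hl k hk
    _ = (∑ l ∈ S, QA l j) * ∑ k ∈ T, QA i k := by rw [sum_mul_sum]
    _ ≤ 1 := mul_le_one₀ hcol (sum_nonneg fun _ _ => hnn _ _) hrow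

/-! ### Perfect matchings and their marginals -/

theorem mem_perfectMatchings {n : ℕ} {E : Fin n → Fin n → Prop} {σ : Equiv.Perm (Fin n)} :
    σ ∈ perfectMatchings E ↔ ∀ i, E i (σ i) := by
  simp [perfectMatchings]

/-- In a Birkhoff decomposition of the scaling, any permutation of positive weight lies in the
support of `QA`, hence uses only edges. -/
theorem perfectMatchings_nonempty {n : ℕ} {E : Fin n → Fin n → Prop}
    {QA : Matrix (Fin n) (Fin n) ℝ} (h : IsScaling (adjMatrix E) QA) :
    (perfectMatchings E).Nonempty := by
  obtain ⟨α, β, -, h0⟩ := h.apply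
  obtain ⟨w, hw, hw1, hwM⟩ := exists_eq_sum_perm_of_mem_doublyStochastic h.1
  obtain ⟨σ, -, hσ⟩ : ∃ σ ∈ (univ : Finset (Equiv.Perm (Fin n))), 0 < w σ := by
    apply exists_lt_of_sum_lt (f := fun _ => (0 : ℝ))
    simp [hw1]
  refine ⟨σ, mem_perfectMatchings.2 fun i => ?_⟩
  by_contra hi
  have h1 := h0 i (σ i) hi
  rw [← hwM, Matrix.sum_apply] at h1
  have h2 : w σ * 1 ≤ ∑ τ : Equiv.Perm (Fin n), (w τ • τ.permMatrix ℝ) i (σ i) := by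
    refine le_trans (le_of_eq ?_) (single_le_sum (f := fun τ : Equiv.Perm (Fin n) =>
      (w τ • τ.permMatrix ℝ) i (σ i)) (fun τ _ => ?_) (mem_univ σ))
    · simp [PEquiv.toMatrix_apply, Equiv.toPEquiv_apply]
    · simp only [Matrix.smul_apply, smul_eq_mul, PEquiv.toMatrix_apply]
      split_ifs
      · simpa using hw τ
      · simp
  linarith

theorem marginal_nonneg {n : ℕ} (E : Fin n → Fin n → Prop) (i j : Fin n) :
    0 ≤ marginal E i j := by
  simp only [marginal, Matrix.of_apply]
  positivity

theorem sum_marginal {n : ℕ} {E : Fin n → Fin n → Prop} (h : (perfectMatchings E).Nonempty)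
    (i : Fin n) : ∑ j, marginal E i j = 1 := by
  simp only [marginal, Matrix.of_apply]
  rw [← sum_div, ← Nat.cast_sum, ← card_eq_sum_card_fiberwise (fun _ _ => mem_coe.2 (mem_univ _))]
  exact div_self (by exact_mod_cast (card_pos.2 h).ne')

/-- Averages over uniformly random perfect matchings of functions of single edges. -/
theorem sum_perfectMatchings_div_card {n : ℕ} (E : Fin n → Fin n → Prop)
    (φ : Fin n → Fin n → ℝ) :
    (∑ σ ∈ perfectMatchings E, ∑ t, φ t (σ t)) / #(perfectMatchings E) =
      ∑ t, ∑ k, marginal E t k * φ t k := by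
  rw [sum_comm, sum_div]
  refine sum_congr rfl fun t _ => ?_
  rw [← sum_fiberwise (perfectMatchings E) (fun σ => σ t), sum_div]
  refine sum_congr rfl fun k _ => ?_
  rw [sum_congr rfl fun σ hσ => by rw [(mem_filter.1 hσ).2], sum_const, nsmul_eq_mul]
  simp only [marginal, Matrix.of_apply]
  ring

theorem marginal_pos_of_mem {n : ℕ} {E : Fin n → Fin n → Prop} {σ : Equiv.Perm (Fin n)}
    (hσ : σ ∈ perfectMatchings E) (i : Fin n) : 0 < marginal E i (σ i) := by
  simp only [marginal, Matrix.of_apply]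
  have h1 : 0 < #{τ ∈ perfectMatchings E | τ i = σ i} :=
    card_pos.2 ⟨σ, mem_filter.2 ⟨hσ, rfl⟩⟩
  have h2 : 0 < #(perfectMatchings E) := card_pos.2 ⟨σ, hσ⟩
  positivity

/-- Rotating the partners of the rows `i`, `a = σ⁻¹ j` and `c` turns the perfect matching `σ` into
one that contains the edge `(x_i, y_j)`. -/
theorem rotate_mem_perfectMatchings {n : ℕ} {E : Fin n → Fin n → Prop} {σ : Equiv.Perm (Fin n)}
    {i j c : Fin n} (hσ : σ ∈ perfectMatchings E) (hij : E i j) (hj : σ i ≠ j)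
    (hci : c ≠ i) (h1 : E c (σ i)) (h2 : E (σ.symm j) (σ c)) :
    σ * (Equiv.swap i (σ.symm j) * Equiv.swap (σ.symm j) c) ∈
      {τ ∈ perfectMatchings E | τ i = j} := by
  set a := σ.symm j with ha
  have haj : σ a = j := by simp [ha]
  have hai : a ≠ i := fun h => hj (by rw [← h, haj])
  have hi : (σ * (Equiv.swap i a * Equiv.swap a c)) i = j := by
    simp [Equiv.swap_apply_of_ne_of_ne hai.symm hci.symm, haj]
  rw [mem_filter, mem_perfectMatchings]
  refine ⟨fun t => ?_, hi⟩
  rw [mem_perfectMatchings] at hσ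
  by_cases hti : t = i
  · rw [hti, hi]; exact hij
  by_cases htc : t = c
  · subst htc
    simpa using h1
  by_cases hta : t = a
  · rw [hta]
    have hca : c ≠ a := fun h => htc (by rw [hta, h])
    simpa [Equiv.swap_apply_of_ne_of_ne hci hca] using h2
  · simpa [Equiv.swap_apply_of_ne_of_ne hta htc, Equiv.swap_apply_of_ne_of_ne hti hta] using hσ t

/-- Switching: each matching that avoids `(i, j)` can be rotated through at least `lam * n` third
rows `c` into one containing it. The result together with `σ.symm j` and `c` recovers the original,
so each matching containing `(i, j)` arises at most `n ^ 2` times. -/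
theorem lam_div_le_marginal {n : ℕ} {lam : ℝ} (hlam : 0 < lam) (hlam' : lam < 1 / 2)
    (hn : 1 ≤ lam * n) {E : Fin n → Fin n → Prop} (hE : IsDense lam E)
    (hne : (perfectMatchings E).Nonempty) {i j : Fin n} (hij : E i j) :
    lam / (2 * n) ≤ marginal E i j := by
  classical
  have hn0 : (0 : ℝ) < n := by
    by_contra h0
    nlinarith [(Nat.cast_nonneg n : (0 : ℝ) ≤ n)]
  have hn1 : (1 : ℝ) ≤ n := by exact_mod_cast (Nat.cast_pos.1 hn0 : 0 < n)
  set B := {σ ∈ perfectMatchings E | σ i = j} with hB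
  set B' := {σ ∈ perfectMatchings E | σ i ≠ j} with hB'
  have hcard : #B + #B' = #(perfectMatchings E) :=
    card_filter_add_card_filter_not (fun σ : Equiv.Perm (Fin n) => σ i = j)
  let C : Equiv.Perm (Fin n) → Finset (Fin n) :=
    fun σ => {c | c ≠ i ∧ E c (σ i) ∧ E (σ.symm j) (σ c)}
  have hC : ∀ σ, lam * n ≤ #(C σ) := by
    intro σ
    set S : Finset (Fin n) := {c | E c (σ i)} with hS
    set T : Finset (Fin n) := {c | E (σ.symm j) (σ c)} with hT
    have hSc : (1 / 2 + lam) * (n : ℝ) ≤ #S := by convert hE.2 (σ i)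
    have hTc : (1 / 2 + lam) * (n : ℝ) ≤ #T := by
      have : #T = #{k | E (σ.symm j) k} := by
        refine card_bij' (fun c _ => σ c) (fun k _ => σ.symm k) ?_ ?_ ?_ ?_ <;> simp [hT]
      rw [this]
      convert hE.1 (σ.symm j)
    have hun : #(S ∪ T) ≤ n := by simpa using card_le_univ (S ∪ T)
    have hint := card_union_add_card_inter S T
    have hCeq : C σ = (S ∩ T).erase i := by
      ext c
      simp [C, hS, hT]
    -- Density gives at least `2 * lam * n` common candidates; excluding `i` loses one, which `1 ≤
    -- lam * n` absorbs.
    have her := pred_card_le_card_erase (s := S ∩ T) (a := i)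
    rw [← hCeq] at her
    have : (#S : ℝ) + #T ≤ n + (#(C σ) + 1) := by
      exact_mod_cast (by omega : #S + #T ≤ n + (#(C σ) + 1))
    linarith
  have hinj : #(B'.sigma C) ≤ #(B ×ˢ (univ : Finset (Fin n × Fin n))) := by
    refine card_le_card_of_injOn (fun x => (x.1 * (Equiv.swap i (x.1.symm j) *
      Equiv.swap (x.1.symm j) x.2), (x.1.symm j, x.2))) ?_ ?_
    · rintro ⟨σ, c⟩ hx
      simp only [coe_sigma, Set.mem_sigma_iff, mem_coe, hB', C, mem_filter, mem_univ,
        true_and] at hx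
      rw [mem_coe, mem_product]
      exact ⟨rotate_mem_perfectMatchings hx.1.1 hij hx.1.2 hx.2.1 hx.2.2.1 hx.2.2.2, mem_univ _⟩
    · rintro ⟨σ, c⟩ - ⟨σ', c'⟩ - h
      simp only [Prod.mk.injEq] at h
      obtain ⟨h1, h2, rfl⟩ := h
      rw [h2] at h1
      have := mul_right_cancel h1
      subst this
      rfl
  rw [card_sigma, card_product, card_univ, Fintype.card_prod, Fintype.card_fin] at hinj
  have h1 : (#B' : ℝ) * (lam * n) ≤ #B * (n * n) := by
    calc (#B' : ℝ) * (lam * n) = ∑ σ ∈ B', lam * n := by rw [sum_const, nsmul_eq_mul]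
      _ ≤ ∑ σ ∈ B', (#(C σ) : ℝ) := sum_le_sum fun σ _ => hC σ
      _ ≤ #B * (n * n) := by exact_mod_cast hinj
  have h2 : (#B' : ℝ) * lam ≤ #B * n := by
    apply le_of_mul_le_mul_right _ hn0
    linarith
  have h3 : (#B : ℝ) + #B' = #(perfectMatchings E) := by exact_mod_cast hcard
  have h4 : (0 : ℝ) < #(perfectMatchings E) := by exact_mod_cast card_pos.2 hne
  have h5 : marginal E i j = #B / #(perfectMatchings E) := by
    simp only [marginal, Matrix.of_apply]
    rfl
  rw [h5, div_le_div_iff₀ (by positivity) h4]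
  have hBn : (0 : ℝ) ≤ #B := Nat.cast_nonneg _
  nlinarith

/-! ### The upper bound for the expected log-probability -/

/-- `(σ * π)⁻¹ j` is the step at which `σ` uses column `j`. A column extendable at step `i` was not
used earlier, so the normalizing sum is at most the sum over columns used at step `i` or later. -/
theorem neg_log_sisProb_le {n : ℕ} {E : Fin n → Fin n → Prop} {Q : Matrix (Fin n) (Fin n) ℝ}
    (hQ : ∀ i j, 0 ≤ Q i j) {σ : Equiv.Perm (Fin n)} (hσ : σ ∈ perfectMatchings E)
    (hpos : ∀ i, 0 < Q i (σ i)) (π : Equiv.Perm (Fin n)) :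
    -Real.log (sisProb E Q π σ) ≤ ∑ t, (-Real.log (Q t (σ t)) +
      Real.log (∑ j with (σ * π)⁻¹ (σ t) ≤ (σ * π)⁻¹ j, Q t j)) := by
  have hext : ∀ i, 0 < ∑ j ∈ extendable E π σ i, Q (π i) j := by
    intro i
    refine (hpos (π i)).trans_le (single_le_sum (f := fun j => Q (π i) j)
      (fun j _ => hQ _ _) ?_)
    simp only [extendable, mem_filter, mem_univ, true_and]
    exact ⟨σ, hσ, fun _ _ => rfl, rfl⟩
  have hsub : ∀ i, extendable E π σ i ⊆
      univ.filter fun j => (σ * π)⁻¹ (σ (π i)) ≤ (σ * π)⁻¹ j := by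
    intro i j hj
    simp only [extendable, mem_filter, mem_univ, true_and] at hj ⊢
    obtain ⟨τ, -, h1, rfl⟩ := hj
    have h2 : (σ * π)⁻¹ (σ (π i)) = i := by simp
    rw [h2]
    by_contra! hlt
    have h3 := h1 _ hlt
    have h4 : σ (π ((σ * π)⁻¹ (τ (π i)))) = τ (π i) := by simp
    rw [h4] at h3
    have h5 := π.injective (τ.injective h3)
    exact hlt.ne h5
  rw [sisProb, Real.log_prod fun i _ => (div_pos (hpos _) (hext i)).ne', ← sum_neg_distrib,
    ← Equiv.sum_comp π (fun t => -Real.log (Q t (σ t)) +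
      Real.log (∑ j with (σ * π)⁻¹ (σ t) ≤ (σ * π)⁻¹ j, Q t j))]
  refine sum_le_sum fun i _ => ?_
  rw [Real.log_div (hpos _).ne' (hext i).ne']
  have := Real.log_le_log (hext i) (sum_le_sum_of_subset_of_nonneg (f := fun j => Q (π i) j)
    (hsub i) fun _ _ _ => hQ _ _)
  linarith

theorem sum_neg_log_sisProb_le {n : ℕ} {E : Fin n → Fin n → Prop} {Q : Matrix (Fin n) (Fin n) ℝ}
    (hQ : ∀ i j, 0 ≤ Q i j) {σ : Equiv.Perm (Fin n)} (hσ : σ ∈ perfectMatchings E)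
    (hpos : ∀ i, 0 < Q i (σ i)) :
    (∑ π : Equiv.Perm (Fin n), -Real.log (sisProb E Q π σ)) / (n.factorial : ℝ) ≤
      ∑ t, (-Real.log (Q t (σ t)) + expectedLogTail Q t (σ t)) := by
  have hf : (0 : ℝ) < n.factorial := by exact_mod_cast n.factorial_pos
  rw [div_le_iff₀ hf]
  refine (sum_le_sum fun π _ => neg_log_sisProb_le hQ hσ hpos π).trans (le_of_eq ?_)
  rw [sum_comm, sum_mul]
  refine sum_congr rfl fun t _ => ?_
  -- For fixed `σ`, `π ↦ (σ * π)⁻¹` is a bijection of permutations, so the order in which columns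
  -- are used is uniform too.
  have hre : ∑ π : Equiv.Perm (Fin n),
      Real.log (∑ j with (σ * π)⁻¹ (σ t) ≤ (σ * π)⁻¹ j, Q t j) =
      ∑ π : Equiv.Perm (Fin n), Real.log (∑ j with π (σ t) ≤ π j, Q t j) :=
    Fintype.sum_equiv ((Equiv.mulLeft σ).trans (Equiv.inv _)) _ _ fun π => rfl
  rw [sum_add_distrib, hre, sum_const, nsmul_eq_mul, card_univ, Fintype.card_perm,
    Fintype.card_fin, expectedLogTail]
  field_simp

theorem expectedNegLog_le_upperBound {n : ℕ} {E : Fin n → Fin n → Prop}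
    {Q : Matrix (Fin n) (Fin n) ℝ} (hQ : ∀ i j, 0 ≤ Q i j) :
    (expectedNegLog E Q : EReal) ≤ upperBound (marginal E) Q := by
  rw [upperBound]
  split_ifs with h
  swap
  · exact le_top
  rw [EReal.coe_le_coe_iff]
  have h1 : expectedNegLog E Q ≤ (∑ σ ∈ perfectMatchings E,
      ∑ t, (-Real.log (Q t (σ t)) + expectedLogTail Q t (σ t))) / #(perfectMatchings E) := by
    rw [expectedNegLog]
    refine div_le_div_of_nonneg_right (sum_le_sum fun σ hσ => ?_) (Nat.cast_nonneg _)
    exact sum_neg_log_sisProb_le hQ hσ fun i =>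
      (hQ _ _).lt_of_ne' (h _ _ (marginal_pos_of_mem hσ i).ne')
  refine h1.trans (le_of_eq ?_)
  rw [sum_perfectMatchings_div_card E (fun t k => -Real.log (Q t k) + expectedLogTail Q t k)]
  simp only [mul_add, sum_add_distrib, mul_neg, sum_neg_distrib]

/-! ### Convexity along exchanges in one row -/

/-- The part of the tail sum of `q` from `k` on, in the order `π`, that avoids `j₁` and `j₂`. -/
noncomputable def tailRest {n : ℕ} (q : Fin n → ℝ) (j₁ j₂ : Fin n) (π : Equiv.Perm (Fin n))
    (k : Fin n) : ℝ :=
  ∑ j with π k ≤ π j ∧ j ≠ j₁ ∧ j ≠ j₂, q j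

/-- The multiple of `-log x` that compensates the concavity of the logarithm of the tail sum from
`k` on, as a function of the `j₁`-entry `x ∈ (0, s)`. -/
noncomputable def tailWeight {n : ℕ} (q : Fin n → ℝ) (s : ℝ) (j₁ j₂ : Fin n)
    (π : Equiv.Perm (Fin n)) (k : Fin n) : ℝ :=
  if π k ≤ π j₁ ∧ π j₂ < π k then (s / (s + tailRest q j₁ j₂ π k)) ^ 2 else 0

theorem tailRest_comm {n : ℕ} (q : Fin n → ℝ) (j₁ j₂ : Fin n) (π : Equiv.Perm (Fin n))
    (k : Fin n) : tailRest q j₁ j₂ π k = tailRest q j₂ j₁ π k := by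
  simp only [tailRest, and_comm (a := _ ≠ j₁)]

theorem tailRest_nonneg {n : ℕ} {q : Fin n → ℝ} (hq : ∀ j, 0 ≤ q j) (j₁ j₂ : Fin n)
    (π : Equiv.Perm (Fin n)) (k : Fin n) : 0 ≤ tailRest q j₁ j₂ π k :=
  sum_nonneg fun _ _ => hq _

theorem sum_tail_exchange {n : ℕ} (Q : Matrix (Fin n) (Fin n) ℝ) {i j₁ j₂ : Fin n} (hj : j₁ ≠ j₂)
    (π : Equiv.Perm (Fin n)) (k : Fin n) (x : ℝ) :
    ∑ j with π k ≤ π j, exchange Q i j₁ j₂ x i j =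
      (if π k ≤ π j₁ then x else 0) + (if π k ≤ π j₂ then Q i j₁ + Q i j₂ - x else 0) +
        tailRest (fun j => Q i j) j₁ j₂ π k := by
  have h : ∀ j, exchange Q i j₁ j₂ x i j = (if j = j₁ then x else 0) +
      (if j = j₂ then Q i j₁ + Q i j₂ - x else 0) + if j ≠ j₁ ∧ j ≠ j₂ then Q i j else 0 := by
    intro j
    simp only [exchange, Matrix.of_apply, true_and]
    by_cases h1 : j = j₁
    · simp [h1, hj]
    · by_cases h2 : j = j₂
      · simp [h2, hj.symm]
      · simp [h1, h2]
  rw [sum_congr rfl fun j _ => h j, sum_add_distrib, sum_add_distrib, sum_ite_eq', sum_ite_eq',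
    ← sum_filter, filter_filter]
  simp [tailRest]

/-- If the tail contains both columns or neither, its sum does not depend on `x` and both weights
vanish. Otherwise it is `x + R` or `s - x + R`, and exactly the matching weight is active. -/
theorem convexOn_log_tail {n : ℕ} {Q : Matrix (Fin n) (Fin n) ℝ} {i j₁ j₂ : Fin n} (hj : j₁ ≠ j₂)
    (hq : ∀ j, 0 ≤ Q i j) (π : Equiv.Perm (Fin n)) (k : Fin n) :
    ConvexOn ℝ (Set.Ioo 0 (Q i j₁ + Q i j₂)) fun x =>
      Real.log (∑ j with π k ≤ π j, exchange Q i j₁ j₂ x i j) -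
        tailWeight (fun j => Q i j) (Q i j₁ + Q i j₂) j₁ j₂ π k * Real.log x -
        tailWeight (fun j => Q i j) (Q i j₁ + Q i j₂) j₂ j₁ π k *
          Real.log (Q i j₁ + Q i j₂ - x) := by
  simp only [sum_tail_exchange Q hj, tailWeight, tailRest_comm _ j₂ j₁]
  have hR := tailRest_nonneg (q := fun j => Q i j) hq j₁ j₂ π k
  generalize tailRest (fun j => Q i j) j₁ j₂ π k = R at *
  generalize Q i j₁ + Q i j₂ = s
  by_cases h1 : π k ≤ π j₁ <;> by_cases h2 : π k ≤ π j₂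
  · have : (fun x : ℝ => Real.log ((if π k ≤ π j₁ then x else 0) +
        (if π k ≤ π j₂ then s - x else 0) + R) -
        (if π k ≤ π j₁ ∧ π j₂ < π k then (s / (s + R)) ^ 2 else 0) * Real.log x -
        (if π k ≤ π j₂ ∧ π j₁ < π k then (s / (s + R)) ^ 2 else 0) * Real.log (s - x)) =
        fun _ => Real.log (s + R) := by
      funext x
      simp [h1, h2, h1.not_gt, h2.not_gt]
    rw [this]
    exact convexOn_const _ (convex_Ioo _ _)
  · have h2' : π j₂ < π k := not_le.1 h2
    have := convexOn_log_add_sub_mul_log (s := s) hR le_rfl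
    simpa [h1, h2, h2'] using this
  · have h1' : π j₁ < π k := not_le.1 h1
    have := convexOn_comp_sub (convexOn_log_add_sub_mul_log (s := s) hR le_rfl)
    simpa [h1, h2, h1'] using this
  · simpa [h1, h2] using convexOn_const (Real.log R) (convex_Ioo 0 s)

/-! ### Bounds for the averaged compensating weights -/

/-- Entries below `1 / (2 * n)` add up to at most 1/2, so the others carry at least 1/2 while each
is at most `1 / (2 * lam * n)`. -/
theorem card_large_entries {n : ℕ} (hn : 0 < n) {lam : ℝ} (hlam : 0 < lam) {q : Fin n → ℝ}
    (hsum : ∑ j, q j = 1) (hle : ∀ j, q j ≤ 1 / (2 * lam * n)) :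
    lam * n ≤ #{j | 1 / (2 * n : ℝ) ≤ q j} := by
  have hn0 : (0 : ℝ) < n := by exact_mod_cast hn
  have h1 := sum_filter_add_sum_filter_not univ (fun j => 1 / (2 * n : ℝ) ≤ q j) q
  have h2 : ∑ j with 1 / (2 * n : ℝ) ≤ q j, q j ≤
      #{j | 1 / (2 * n : ℝ) ≤ q j} * (1 / (2 * lam * n)) := by
    rw [← nsmul_eq_mul]
    exact sum_le_card_nsmul _ _ _ fun j _ => hle j
  have h3 : ∑ j with ¬ 1 / (2 * n : ℝ) ≤ q j, q j ≤ 1 / 2 := by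
    calc ∑ j with ¬ 1 / (2 * n : ℝ) ≤ q j, q j
        ≤ ∑ j with ¬ 1 / (2 * n : ℝ) ≤ q j, 1 / (2 * n : ℝ) :=
          sum_le_sum fun j hj => (not_le.1 (mem_filter.1 hj).2).le
      _ ≤ ∑ j : Fin n, 1 / (2 * n : ℝ) :=
          sum_le_sum_of_subset_of_nonneg (subset_univ _) fun _ _ _ => by positivity
      _ = 1 / 2 := by
          rw [sum_const, nsmul_eq_mul, card_univ, Fintype.card_fin]
          field_simp
  have h4 : 1 / 2 ≤ #{j | 1 / (2 * n : ℝ) ≤ q j} * (1 / (2 * lam * n)) := by linarith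
  rw [mul_one_div, div_le_div_iff₀ (by norm_num) (by positivity)] at h4
  linarith

theorem tailWeight_le_one {n : ℕ} {q : Fin n → ℝ} (hq : ∀ j, 0 ≤ q j) {s : ℝ} (hs : 0 < s)
    (j₁ j₂ : Fin n) (π : Equiv.Perm (Fin n)) (k : Fin n) :
    tailWeight q s j₁ j₂ π k ≤ if π k ≤ π j₁ ∧ π j₂ < π k then 1 else 0 := by
  rw [tailWeight]
  have hR := tailRest_nonneg hq j₁ j₂ π k
  split_ifs
  · exact pow_le_one₀ (by positivity) ((div_le_one (by positivity)).2 (by linarith))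
  · exact le_rfl

theorem sum_tailWeight_self_le {n : ℕ} {q : Fin n → ℝ} (hq : ∀ j, 0 ≤ q j) {s : ℝ} (hs : 0 < s)
    {j₁ j₂ : Fin n} (hj : j₁ ≠ j₂) :
    (∑ π, tailWeight q s j₁ j₂ π j₁) / (n.factorial : ℝ) ≤ 1 / 2 := by
  have hf : (0 : ℝ) < n.factorial := by exact_mod_cast n.factorial_pos
  rw [div_le_iff₀ hf]
  -- Among `{j₁, j₂}`, having rank 0 means that `j₁` comes last, which has probability 1/2.
  have h1 := sum_perm_rank (mem_insert_self j₁ {j₂}) (fun r : ℕ => if r = 0 then (1 : ℝ) else 0)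
  rw [card_pair hj] at h1
  have h2 : ∀ π : Equiv.Perm (Fin n), tailWeight q s j₁ j₂ π j₁ ≤
      if #{j ∈ ({j₁, j₂} : Finset (Fin n)) | π j₁ < π j} = 0 then 1 else 0 := by
    intro π
    refine (tailWeight_le_one hq hs j₁ j₂ π j₁).trans ?_
    by_cases h : π j₂ < π j₁
    · simp [h, card_eq_zero, filter_eq_empty_iff, h.le]
    · simp only [h, and_false, if_false]
      split_ifs <;> norm_num
  refine (sum_le_sum fun π _ => h2 π).trans ?_
  rw [h1]
  norm_num [sum_range_succ]
  linarith

/-- With `m` elements of `L` after `k`, the rest satisfies `R ≥ m / (2 n)`, while `s ≤ 1 / (lam n)`;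
hence `s / (s + R) ≤ 2 / (lam (m + 1))`. Inserting `j₁`, itself after `k`, turns the count `m` into
`m + 1`. -/
theorem tailWeight_le_inv_sq {n : ℕ} (hn : 0 < n) {lam : ℝ} (hlam : 0 < lam) (hlam' : lam < 1 / 2)
    {q : Fin n → ℝ} (hq : ∀ j, 0 ≤ q j) {s : ℝ} (hs : 0 < s) (hs' : s ≤ 1 / (lam * n))
    {j₁ j₂ k : Fin n} (hk : k ≠ j₁) {L : Finset (Fin n)}
    (hL : ∀ j ∈ L, 1 / (2 * n : ℝ) ≤ q j ∧ j ≠ j₁ ∧ j ≠ j₂) (π : Equiv.Perm (Fin n)) :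
    tailWeight q s j₁ j₂ π k ≤
      4 / lam ^ 2 * (if π k < π j₁ then
        ((#{l ∈ insert j₁ L | π k < π l} : ℝ) ^ 2)⁻¹ else 0) := by
  have hn0 : (0 : ℝ) < n := by exact_mod_cast hn
  rw [tailWeight]
  by_cases h : π k ≤ π j₁ ∧ π j₂ < π k
  swap
  · rw [if_neg h]
    split_ifs <;> positivity
  have hlt : π k < π j₁ := h.1.lt_of_ne fun h' => hk (π.injective h')
  have hj₁ : j₁ ∉ L := fun h' => (hL _ h').2.1 rfl
  rw [if_pos h, if_pos hlt, filter_insert, if_pos hlt, card_insert_of_notMem (by simp [hj₁])]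
  have hR : (#{l ∈ L | π k < π l} : ℝ) * (1 / (2 * n)) ≤ tailRest q j₁ j₂ π k := by
    rw [← nsmul_eq_mul]
    refine (card_nsmul_le_sum _ (fun j => q j) _ fun j hj => (hL j (mem_filter.1 hj).1).1).trans ?_
    refine sum_le_sum_of_subset_of_nonneg (fun j hj => ?_) fun _ _ _ => hq _
    rw [mem_filter] at hj
    simp [hj.2.le, (hL j hj.1).2]
  generalize tailRest q j₁ j₂ π k = R at *
  generalize #{l ∈ L | π k < π l} = m at *
  have hsn : lam * s ≤ 1 / n := by
    rw [le_div_iff₀ (by positivity)] at hs' ⊢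
    linarith
  have hm : (0 : ℝ) ≤ m := Nat.cast_nonneg m
  have hRs : (m : ℝ) * (lam * s) ≤ 2 * R := by
    have h3 : (m : ℝ) * (1 / (2 * n)) = m * (1 / n) / 2 := by field_simp
    have h4 := mul_le_mul_of_nonneg_left hsn hm
    linarith
  have hR0 : 0 ≤ R := by
    have : 0 ≤ (m : ℝ) * (lam * s) := by positivity
    linarith
  have hkey : s / (s + R) ≤ 2 / lam * ((m : ℝ) + 1)⁻¹ := by
    rw [← div_eq_mul_inv, div_div, div_le_div_iff₀ (by positivity) (by positivity)]
    nlinarith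
  calc (s / (s + R)) ^ 2 ≤ (2 / lam * ((m : ℝ) + 1)⁻¹) ^ 2 :=
        pow_le_pow_left₀ (by positivity) hkey 2
    _ = 4 / lam ^ 2 * (((m + 1 : ℕ) : ℝ) ^ 2)⁻¹ := by
        push_cast
        rw [mul_pow, div_pow, inv_pow]
        norm_num

theorem sum_tailWeight_le {n : ℕ} (hn : 0 < n) {lam : ℝ} (hlam : 0 < lam) (hlam' : lam < 1 / 2)
    (hn6 : 6 ≤ lam * n)
    (hces : ∀ m : ℕ, lam * n / 2 ≤ m → (∑ r ∈ range m, (r : ℝ)⁻¹) / m ≤ lam ^ 4 / 32)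
    {q : Fin n → ℝ} (hq : ∀ j, 0 ≤ q j) (hsum : ∑ j, q j = 1)
    (hle : ∀ j, q j ≤ 1 / (2 * lam * n)) {s : ℝ} (hs : 0 < s) (hs' : s ≤ 1 / (lam * n))
    {j₁ j₂ k : Fin n} (hk : k ≠ j₁) :
    (∑ π, tailWeight q s j₁ j₂ π k) / (n.factorial : ℝ) ≤ lam / (4 * n) := by
  have hn0 : (0 : ℝ) < n := by exact_mod_cast hn
  have hf : (0 : ℝ) < n.factorial := by exact_mod_cast n.factorial_pos
  set L : Finset (Fin n) :=
    ({j | 1 / (2 * n : ℝ) ≤ q j} : Finset (Fin n)) \ {j₁, j₂, k} with hLdef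
  have hL : ∀ j ∈ L, 1 / (2 * n : ℝ) ≤ q j ∧ j ≠ j₁ ∧ j ≠ j₂ := by
    intro j hj
    simp only [hLdef, mem_sdiff, mem_filter, mem_univ, true_and, mem_insert, mem_singleton,
      not_or] at hj
    exact ⟨hj.1, hj.2.1, hj.2.2.1⟩
  have hj₁ : j₁ ∉ L := fun h' => (hL _ h').2.1 rfl
  have hkL : k ∉ insert j₁ L := by simp [hLdef, hk]
  -- Removing three columns and adding `j₁` back loses at most 2 from `lam * n`; `6 ≤ lam * n`
  -- leaves at least half.
  have hcard : lam * n / 2 ≤ #(insert j₁ L) := by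
    have h1 := card_large_entries hn hlam hsum hle
    have h2 : #{j | 1 / (2 * n : ℝ) ≤ q j} ≤ #L + 3 := by
      have h3 := le_card_sdiff ({j₁, j₂, k} : Finset (Fin n)) {j | 1 / (2 * n : ℝ) ≤ q j}
      rw [← hLdef] at h3
      have h4 : #({j₁, j₂, k} : Finset (Fin n)) ≤ 3 := card_le_three
      omega
    have h2' : (#{j | 1 / (2 * n : ℝ) ≤ q j} : ℝ) ≤ #L + 3 := by exact_mod_cast h2
    rw [card_insert_of_notMem hj₁]
    push_cast
    linarith
  have hbound : ∑ π, tailWeight q s j₁ j₂ π k ≤ 4 / lam ^ 2 * (n.factorial *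
      ((∑ r ∈ range (#(insert j₁ L) + 1), (r : ℝ)⁻¹) / (#(insert j₁ L) + 1 : ℕ)) /
        #(insert j₁ L)) := by
    rw [← sum_perm_above_inv_sq (mem_insert_self j₁ L) hkL, mul_sum]
    exact sum_le_sum fun π _ => tailWeight_le_inv_sq hn hlam hlam' hq hs hs' hk hL π
  generalize #(insert j₁ L) = m at *
  have hc := hces (m + 1) (by push_cast; linarith)
  have hm : (0 : ℝ) < m := by
    have : 0 < lam * n / 2 := by positivity
    linarith
  rw [div_le_iff₀ hf]
  refine hbound.trans ?_
  -- The threshold `lam ^ 4 / 32` in `hces` is chosen so that this product is exactly `lam / (4 *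
  -- n)`.
  calc 4 / lam ^ 2 * (n.factorial * ((∑ r ∈ range (m + 1), (r : ℝ)⁻¹) / (m + 1 : ℕ)) / m)
      ≤ 4 / lam ^ 2 * (n.factorial * (lam ^ 4 / 32) / (lam * n / 2)) := by
        gcongr
    _ = lam / (4 * n) * n.factorial := by
        field_simp
        norm_num

/-- The term `k = j₁` uses half of `p j₁`; the remaining terms average to at most `lam / (4 * n)`,
half of the lower bound for `p j₁`. -/
theorem sum_mul_tailWeight_le {n : ℕ} (hn : 0 < n) {lam : ℝ} (hlam : 0 < lam)
    (hlam' : lam < 1 / 2) (hn6 : 6 ≤ lam * n)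
    (hces : ∀ m : ℕ, lam * n / 2 ≤ m → (∑ r ∈ range m, (r : ℝ)⁻¹) / m ≤ lam ^ 4 / 32)
    {q : Fin n → ℝ} (hq : ∀ j, 0 ≤ q j) (hsum : ∑ j, q j = 1)
    (hle : ∀ j, q j ≤ 1 / (2 * lam * n)) {s : ℝ} (hs : 0 < s) (hs' : s ≤ 1 / (lam * n))
    {p : Fin n → ℝ} (hp : ∀ k, 0 ≤ p k) (hp1 : ∑ k, p k = 1)
    {j₁ j₂ : Fin n} (hj : j₁ ≠ j₂) (hpj : lam / (2 * n) ≤ p j₁) :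
    ∑ k, p k * ((∑ π, tailWeight q s j₁ j₂ π k) / (n.factorial : ℝ)) ≤ p j₁ := by
  have hn0 : (0 : ℝ) < n := by exact_mod_cast hn
  have h1 : ∀ k, p k * ((∑ π, tailWeight q s j₁ j₂ π k) / (n.factorial : ℝ)) ≤
      p k * (lam / (4 * n)) + if k = j₁ then p j₁ * (1 / 2) else 0 := by
    intro k
    by_cases hk : k = j₁
    · subst hk
      rw [if_pos rfl]
      have := mul_le_mul_of_nonneg_left (sum_tailWeight_self_le hq hs hj) (hp k)
      have h0 : 0 ≤ p k * (lam / (4 * n)) := mul_nonneg (hp k) (by positivity)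
      linarith
    · rw [if_neg hk, add_zero]
      exact mul_le_mul_of_nonneg_left
        (sum_tailWeight_le hn hlam hlam' hn6 hces hq hsum hle hs hs' hk) (hp k)
  refine (sum_le_sum fun k _ => h1 k).trans ?_
  rw [sum_add_distrib, ← sum_mul, hp1, sum_ite_eq', if_pos (mem_univ _)]
  have : lam / (2 * n) = 2 * (lam / (4 * n)) := by field_simp; norm_num
  linarith

/-! ### Assembling the convexity of the functional -/

theorem convexOn_sum {ι : Type*} {S : Set ℝ} (hS : Convex ℝ S) (I : Finset ι) {f : ι → ℝ → ℝ}
    (hf : ∀ k ∈ I, ConvexOn ℝ S (f k)) : ConvexOn ℝ S fun x => ∑ k ∈ I, f k x := by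
  classical
  induction I using Finset.induction_on with
  | empty => simpa using convexOn_const 0 hS
  | insert a I ha ih =>
    simp only [sum_insert ha]
    exact (hf a (mem_insert_self a I)).add (ih fun k hk => hf k (mem_insert_of_mem hk))

theorem convexOn_neg_log (s : ℝ) : ConvexOn ℝ (Set.Ioo 0 s) fun x => -Real.log x :=
  (strictConcaveOn_log_Ioi.concaveOn.neg).subset (fun _ hx => hx.1) (convex_Ioo 0 s)

theorem sum_mul_log_exchange {n : ℕ} (p : Fin n → ℝ) (Q : Matrix (Fin n) (Fin n) ℝ)
    {i j₁ j₂ : Fin n} (hj : j₁ ≠ j₂) (x : ℝ) :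
    ∑ k, p k * Real.log (exchange Q i j₁ j₂ x i k) =
      ∑ k, (if k = j₁ ∨ k = j₂ then 0 else p k * Real.log (Q i k)) +
        p j₁ * Real.log x + p j₂ * Real.log (Q i j₁ + Q i j₂ - x) := by
  have h : ∀ k, p k * Real.log (exchange Q i j₁ j₂ x i k) =
      (if k = j₁ ∨ k = j₂ then 0 else p k * Real.log (Q i k)) +
        (if k = j₁ then p j₁ * Real.log x else 0) +
        (if k = j₂ then p j₂ * Real.log (Q i j₁ + Q i j₂ - x) else 0) := by
    intro k
    simp only [exchange, Matrix.of_apply, true_and]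
    by_cases h1 : k = j₁
    · simp [h1, hj]
    · by_cases h2 : k = j₂
      · simp [h2, hj.symm]
      · simp [h1, h2]
  rw [sum_congr rfl fun k _ => h k, sum_add_distrib, sum_add_distrib, sum_ite_eq', sum_ite_eq',
    if_pos (mem_univ _), if_pos (mem_univ _)]

/-- The contribution of the exchanged row is convex as soon as the weights of the two entries
dominate the compensating weights. -/
theorem convexOn_row_exchange {n : ℕ} {Q : Matrix (Fin n) (Fin n) ℝ} {i j₁ j₂ : Fin n}
    (hj : j₁ ≠ j₂) (hq : ∀ j, 0 ≤ Q i j) {p : Fin n → ℝ} (hp : ∀ k, 0 ≤ p k)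
    (h₁ : ∑ k, p k * ((∑ π, tailWeight (fun j => Q i j) (Q i j₁ + Q i j₂) j₁ j₂ π k) /
      (n.factorial : ℝ)) ≤ p j₁)
    (h₂ : ∑ k, p k * ((∑ π, tailWeight (fun j => Q i j) (Q i j₁ + Q i j₂) j₂ j₁ π k) /
      (n.factorial : ℝ)) ≤ p j₂) :
    ConvexOn ℝ (Set.Ioo 0 (Q i j₁ + Q i j₂)) fun x =>
      -(∑ k, p k * Real.log (exchange Q i j₁ j₂ x i k)) +
        ∑ k, p k * expectedLogTail (exchange Q i j₁ j₂ x) i k := by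
  set s := Q i j₁ + Q i j₂ with hs
  set A := ∑ k, p k * ((∑ π, tailWeight (fun j => Q i j) s j₁ j₂ π k) / (n.factorial : ℝ))
    with hA
  set B := ∑ k, p k * ((∑ π, tailWeight (fun j => Q i j) s j₂ j₁ π k) / (n.factorial : ℝ))
    with hB
  have hC : Convex ℝ (Set.Ioo 0 s) := convex_Ioo 0 s
  have hmain : ConvexOn ℝ (Set.Ioo 0 s) fun x => ∑ k, ∑ π : Equiv.Perm (Fin n),
      (p k / (n.factorial : ℝ)) • (Real.log (∑ j with π k ≤ π j, exchange Q i j₁ j₂ x i j) -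
        tailWeight (fun j => Q i j) s j₁ j₂ π k * Real.log x -
        tailWeight (fun j => Q i j) s j₂ j₁ π k * Real.log (s - x)) :=
    convexOn_sum hC _ fun k _ => convexOn_sum hC _ fun π _ =>
      (convexOn_log_tail hj hq π k).smul (div_nonneg (hp k) (Nat.cast_nonneg _))
  -- What is left of the coefficients of `-log x` and `-log (s - x)` after paying the compensating
  -- weights is nonnegative.
  have hx := (convexOn_neg_log s).smul (sub_nonneg.2 h₁)
  have hy := (convexOn_comp_sub (convexOn_neg_log s)).smul (sub_nonneg.2 h₂)
  have hc := convexOn_const (-∑ k, (if k = j₁ ∨ k = j₂ then 0 else p k * Real.log (Q i k))) hC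
  refine ((hmain.add (hx.add hy)).add hc).congr fun x _ => ?_
  simp only [Pi.add_apply, smul_eq_mul]
  rw [sum_mul_log_exchange p Q hj x]
  have hsplit : ∑ k, ∑ π : Equiv.Perm (Fin n), p k / (n.factorial : ℝ) *
      (Real.log (∑ j with π k ≤ π j, exchange Q i j₁ j₂ x i j) -
        tailWeight (fun j => Q i j) s j₁ j₂ π k * Real.log x -
        tailWeight (fun j => Q i j) s j₂ j₁ π k * Real.log (s - x)) =
      ∑ k, p k * expectedLogTail (exchange Q i j₁ j₂ x) i k - A * Real.log x -
        B * Real.log (s - x) := by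
    rw [hA, hB, sum_mul, sum_mul, ← sum_sub_distrib, ← sum_sub_distrib]
    refine sum_congr rfl fun k _ => ?_
    rw [← mul_sum, sum_sub_distrib, sum_sub_distrib, ← sum_mul, ← sum_mul, expectedLogTail]
    ring
  rw [hsplit]
  ring

theorem expectedLogTail_congr {n : ℕ} {Q Q' : Matrix (Fin n) (Fin n) ℝ} {t : Fin n}
    (h : ∀ j, Q t j = Q' t j) (k : Fin n) : expectedLogTail Q t k = expectedLogTail Q' t k := by
  simp only [expectedLogTail, h]

theorem exchange_apply_of_ne {n : ℕ} (Q : Matrix (Fin n) (Fin n) ℝ) {i t : Fin n} (j₁ j₂ : Fin n)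
    (ht : t ≠ i) (x : ℝ) (j : Fin n) : exchange Q i j₁ j₂ x t j = Q t j := by
  simp [exchange, ht]

theorem convexOn_exchange {n : ℕ} {P Q : Matrix (Fin n) (Fin n) ℝ} {i j₁ j₂ : Fin n}
    (h : ConvexOn ℝ (Set.Ioo 0 (Q i j₁ + Q i j₂)) fun x =>
      -(∑ k, P i k * Real.log (exchange Q i j₁ j₂ x i k)) +
        ∑ k, P i k * expectedLogTail (exchange Q i j₁ j₂ x) i k) :
    ConvexOn ℝ (Set.Ioo 0 (Q i j₁ + Q i j₂)) fun x =>
      -(∑ t, ∑ k, P t k * Real.log (exchange Q i j₁ j₂ x t k)) +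
        ∑ t, ∑ k, P t k * expectedLogTail (exchange Q i j₁ j₂ x) t k := by
  have hC : Convex ℝ (Set.Ioo 0 (Q i j₁ + Q i j₂)) := convex_Ioo _ _
  have h1 : ∀ t ∈ (univ : Finset (Fin n)), ConvexOn ℝ (Set.Ioo 0 (Q i j₁ + Q i j₂)) fun x =>
      -(∑ k, P t k * Real.log (exchange Q i j₁ j₂ x t k)) +
        ∑ k, P t k * expectedLogTail (exchange Q i j₁ j₂ x) t k := by
    intro t _
    by_cases ht : t = i
    · rw [ht]; exact h
    · have he := exchange_apply_of_ne Q j₁ j₂ ht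
      simp only [he, fun x => expectedLogTail_congr (he x)]
      exact convexOn_const _ hC
  have h2 := convexOn_sum hC univ h1
  simpa only [sum_add_distrib, sum_neg_distrib] using h2

/-! ### Extended-real convexity -/

/-- With the value `⊤` at both endpoints, the inequality is trivial unless both points are interior
or `θ` is 0 or 1, so no continuity at the boundary is needed. -/
theorem convexOnEReal_of_convexOn {s : ℝ} {g : ℝ → EReal} {f : ℝ → ℝ}
    (hf : ConvexOn ℝ (Set.Ioo 0 s) f) (hg : ∀ x ∈ Set.Ioo 0 s, g x = f x) (h0 : g 0 = ⊤)
    (hs : g s = ⊤) : ConvexOnEReal (Set.Icc 0 s) g := by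
  have hcase : ∀ z ∈ Set.Icc 0 s, g z = ⊤ ∨ (z ∈ Set.Ioo 0 s ∧ g z = f z) := by
    intro z hz
    rcases hz.1.eq_or_lt with rfl | h1
    · exact Or.inl h0
    rcases hz.2.eq_or_lt with rfl | h2
    · exact Or.inl hs
    exact Or.inr ⟨⟨h1, h2⟩, hg z ⟨h1, h2⟩⟩
  have hbot : ∀ z ∈ Set.Icc 0 s, ∀ c : ℝ, 0 < c → (c : EReal) * g z ≠ ⊥ := by
    intro z hz c hc
    rcases hcase z hz with h | ⟨-, h⟩
    · rw [h, EReal.coe_mul_top_of_pos hc]; simp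
    · rw [h, ← EReal.coe_mul]; exact EReal.coe_ne_bot _
  intro x hx y hy θ hθ hθ'
  rcases hθ.eq_or_lt with rfl | hθ0
  · simp
  rcases hθ'.eq_or_lt with rfl | hθ1
  · simp
  have hθ2 : 0 < 1 - θ := sub_pos.2 hθ1
  rcases hcase x hx with h | ⟨hx', h⟩
  · rw [h, EReal.coe_mul_top_of_pos hθ0, EReal.top_add_of_ne_bot (hbot y hy _ hθ2)]
    exact le_top
  rcases hcase y hy with h' | ⟨hy', h'⟩
  · rw [h', EReal.coe_mul_top_of_pos hθ2, EReal.add_top_of_ne_bot (hbot x hx _ hθ0)]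
    exact le_top
  have hc := hf.2 hx' hy' hθ hθ2.le (by ring)
  have hm := hf.1 hx' hy' hθ hθ2.le (by ring)
  simp only [smul_eq_mul] at hc hm
  rw [h, h', hg _ hm, ← EReal.coe_mul, ← EReal.coe_mul, ← EReal.coe_add, EReal.coe_le_coe_iff]
  exact hc

theorem convexOnEReal_top {S : Set ℝ} {g : ℝ → EReal} (hg : ∀ x, g x = ⊤) :
    ConvexOnEReal S g := by
  intro x _ y _ θ hθ hθ'
  rw [hg x, hg y]
  rcases hθ.eq_or_lt with rfl | hθ0
  · simp
  rcases hθ'.eq_or_lt with rfl | hθ1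
  · simp
  rw [EReal.coe_mul_top_of_pos hθ0, EReal.coe_mul_top_of_pos (sub_pos.2 hθ1)]
  simp

theorem ConvexOnEReal.le_max {S : Set ℝ} {g : ℝ → EReal} (hg : ConvexOnEReal S g) {u v z : ℝ}
    (hu : u ∈ S) (hv : v ∈ S) (huz : u ≤ z) (hzv : z ≤ v) : g z ≤ max (g u) (g v) := by
  rcases huz.eq_or_lt with rfl | huz'
  · exact le_max_left _ _
  have huv : 0 < v - u := by linarith
  set θ := (v - z) / (v - u) with hθ
  have hθ0 : 0 ≤ θ := div_nonneg (by linarith) huv.le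
  have hθ1 : θ ≤ 1 := (div_le_one huv).2 (by linarith)
  have hz : z = θ * u + (1 - θ) * v := by
    rw [hθ]; field_simp; ring
  have h1 : (0 : EReal) ≤ (θ : EReal) := by exact_mod_cast hθ0
  have h2 : (0 : EReal) ≤ ((1 - θ : ℝ) : EReal) := by exact_mod_cast sub_nonneg.2 hθ1
  calc g z ≤ (θ : EReal) * g u + ((1 - θ : ℝ) : EReal) * g v := by
        conv_lhs => rw [hz]
        exact hg u hu v hv θ hθ0 hθ1
    _ ≤ (θ : EReal) * max (g u) (g v) + ((1 - θ : ℝ) : EReal) * max (g u) (g v) :=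
        add_le_add (mul_le_mul_of_nonneg_left (le_max_left _ _) h1)
          (mul_le_mul_of_nonneg_left (le_max_right _ _) h2)
    _ = max (g u) (g v) := by
        rw [← EReal.right_distrib_of_nonneg h1 h2, ← EReal.coe_add]
        simp

/-- Positive marginals at both exchanged positions force the value `⊤` at the endpoints. A zero of
`Q` at any other position where `P` is nonzero persists under every exchange and makes the function
constantly `⊤`. -/
theorem convexOnEReal_upperBound_exchange {n : ℕ} {P Q : Matrix (Fin n) (Fin n) ℝ}
    {i j₁ j₂ : Fin n} (hj : j₁ ≠ j₂) (h₁ : P i j₁ ≠ 0) (h₂ : P i j₂ ≠ 0)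
    (h : ConvexOn ℝ (Set.Ioo 0 (Q i j₁ + Q i j₂)) fun x =>
      -(∑ t, ∑ k, P t k * Real.log (exchange Q i j₁ j₂ x t k)) +
        ∑ t, ∑ k, P t k * expectedLogTail (exchange Q i j₁ j₂ x) t k) :
    ConvexOnEReal (Set.Icc 0 (Q i j₁ + Q i j₂))
      (fun x => upperBound P (exchange Q i j₁ j₂ x)) := by
  have hx1 : ∀ x, exchange Q i j₁ j₂ x i j₁ = x := fun x => by simp [exchange]
  have hx2 : ∀ x, exchange Q i j₁ j₂ x i j₂ = Q i j₁ + Q i j₂ - x := fun x => by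
    simp [exchange, hj.symm]
  have hx3 : ∀ x t k, ¬ (t = i ∧ k = j₁) → ¬ (t = i ∧ k = j₂) →
      exchange Q i j₁ j₂ x t k = Q t k := fun x t k h1 h2 => by
    simp [exchange, h1, h2]
  by_cases hsupp : ∀ t k, P t k ≠ 0 → ¬ (t = i ∧ k = j₁) → ¬ (t = i ∧ k = j₂) → Q t k ≠ 0
  · refine convexOnEReal_of_convexOn h (fun x hx => ?_) ?_ ?_
    · simp only [upperBound]
      rw [if_pos]
      intro t k hP
      by_cases e1 : t = i ∧ k = j₁
      · rw [e1.1, e1.2, hx1]; exact hx.1.ne'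
      by_cases e2 : t = i ∧ k = j₂
      · rw [e2.1, e2.2, hx2]; exact (sub_pos.2 hx.2).ne'
      rw [hx3 x t k e1 e2]
      exact hsupp t k hP e1 e2
    · simp only [upperBound]
      rw [if_neg]
      exact fun hall => hall i j₁ h₁ (hx1 0)
    · simp only [upperBound]
      rw [if_neg]
      exact fun hall => hall i j₂ h₂ (by rw [hx2, sub_self])
  · push Not at hsupp
    obtain ⟨t, k, hP, e1, e2, hQ⟩ := hsupp
    refine convexOnEReal_top fun x => ?_
    simp only [upperBound]
    rw [if_neg]
    exact fun hall => hall t k hP (by rw [hx3 x t k (fun h => e1 h.1 h.2) (fun h => e2 h.1 h.2), hQ])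

/-! ### Extremal matrices in the class -/

theorem exchange_self {n : ℕ} (Q : Matrix (Fin n) (Fin n) ℝ) (i j₁ j₂ : Fin n) :
    exchange Q i j₁ j₂ (Q i j₁) = Q := by
  ext a b
  simp only [exchange, Matrix.of_apply]
  split_ifs with h1 h2
  · rw [h1.1, h1.2]
  · rw [h2.1, h2.2]; ring
  · rfl

theorem sum_exchange {n : ℕ} (Q : Matrix (Fin n) (Fin n) ℝ) {i j₁ j₂ : Fin n} (hj : j₁ ≠ j₂)
    (x : ℝ) (a : Fin n) : ∑ b, exchange Q i j₁ j₂ x a b = ∑ b, Q a b := by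
  by_cases ha : a = i
  · subst ha
    have h : ∀ b, exchange Q a j₁ j₂ x a b = Q a b + (if b = j₁ then x - Q a j₁ else 0) +
        (if b = j₂ then Q a j₁ - x else 0) := by
      intro b
      simp only [exchange, Matrix.of_apply, true_and]
      by_cases h1 : b = j₁
      · simp [h1, hj]
      · by_cases h2 : b = j₂
        · simp [h2, hj.symm]; ring
        · simp [h1, h2]
    rw [sum_congr rfl fun b _ => h b, sum_add_distrib, sum_add_distrib, sum_ite_eq', sum_ite_eq',
      if_pos (mem_univ _), if_pos (mem_univ _)]
    ring
  · exact sum_congr rfl fun b _ => exchange_apply_of_ne Q j₁ j₂ ha x b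

theorem mem_classQ_iff {n : ℕ} {QA Q : Matrix (Fin n) (Fin n) ℝ} :
    Q ∈ classQ QA ↔ (∀ i j, 0 ≤ Q i j) ∧ (∀ i, ∑ j, Q i j = 1) ∧
      (∀ i j, Q i j ≤ rowMax QA i / (n : ℝ)) ∧ ∀ i j, 0 < Q i j → 0 < QA i j := by
  simp only [classQ, Set.mem_ofPred_eq, Matrix.mem_rowStochastic_iff_sum, and_assoc]

theorem exchange_mem_classQ {n : ℕ} {QA Q : Matrix (Fin n) (Fin n) ℝ} (hQ : Q ∈ classQ QA)
    {i j₁ j₂ : Fin n} (hj : j₁ ≠ j₂) (h₁ : 0 < Q i j₁) (h₂ : 0 < Q i j₂) {x : ℝ} (hx : 0 ≤ x)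
    (hx' : x ≤ Q i j₁ + Q i j₂) (hxr : x ≤ rowMax QA i / (n : ℝ))
    (hxr' : Q i j₁ + Q i j₂ - x ≤ rowMax QA i / (n : ℝ)) : exchange Q i j₁ j₂ x ∈ classQ QA := by
  obtain ⟨hnn, hsum, hle, hpos⟩ := mem_classQ_iff.1 hQ
  refine mem_classQ_iff.2 ⟨fun a b => ?_, fun a => ?_, fun a b => ?_, fun a b => ?_⟩
  · simp only [exchange, Matrix.of_apply]
    split_ifs
    · exact hx
    · linarith
    · exact hnn a b
  · rw [sum_exchange Q hj, hsum]
  · simp only [exchange, Matrix.of_apply]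
    split_ifs with e1 e2
    · rw [e1.1]; exact hxr
    · rw [e2.1]; exact hxr'
    · exact hle a b
  · simp only [exchange, Matrix.of_apply]
    split_ifs with e1 e2
    · rw [e1.1, e1.2]; exact fun _ => hpos _ _ h₁
    · rw [e2.1, e2.2]; exact fun _ => hpos _ _ h₂
    · exact hpos a b

open scoped Classical in
/-- The positions of the entries that are neither zero nor maximal. -/
noncomputable def fractional {n : ℕ} (QA Q : Matrix (Fin n) (Fin n) ℝ) :
    Finset (Fin n × Fin n) :=
  {e | Q e.1 e.2 ≠ 0 ∧ Q e.1 e.2 ≠ rowMax QA e.1 / (n : ℝ)}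

theorem mem_fractional {n : ℕ} {QA Q : Matrix (Fin n) (Fin n) ℝ} {a b : Fin n} :
    (a, b) ∈ fractional QA Q ↔ Q a b ≠ 0 ∧ Q a b ≠ rowMax QA a / (n : ℝ) := by
  simp [fractional]

theorem card_fractional_exchange_lt {n : ℕ} {QA Q : Matrix (Fin n) (Fin n) ℝ} {i j₁ j₂ : Fin n}
    (hj : j₁ ≠ j₂) (h₁ : (i, j₁) ∈ fractional QA Q) (h₂ : (i, j₂) ∈ fractional QA Q) {x : ℝ}
    (hx : (x = 0 ∨ x = rowMax QA i / (n : ℝ)) ∨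
      (Q i j₁ + Q i j₂ - x = 0 ∨ Q i j₁ + Q i j₂ - x = rowMax QA i / (n : ℝ))) :
    #(fractional QA (exchange Q i j₁ j₂ x)) < #(fractional QA Q) := by
  have hsub : fractional QA (exchange Q i j₁ j₂ x) ⊆ fractional QA Q := by
    rintro ⟨a, b⟩ hab
    by_cases e1 : a = i ∧ b = j₁
    · rw [e1.1, e1.2]; exact h₁
    by_cases e2 : a = i ∧ b = j₂
    · rw [e2.1, e2.2]; exact h₂
    rw [mem_fractional] at hab ⊢
    simpa [exchange, e1, e2] using hab
  apply card_lt_card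
  refine ⟨hsub, fun hsup => ?_⟩
  rcases hx with hx | hx
  · have := mem_fractional.1 (hsup h₁)
    simp only [exchange, Matrix.of_apply, and_self, if_true] at this
    tauto
  · have := mem_fractional.1 (hsup h₂)
    simp only [exchange, Matrix.of_apply, true_and, hj.symm, if_false, if_true] at this
    tauto

/-- A functional that is convex along exchanges is maximized, over the class, at matrices with at
most one fractional entry in each row. -/
theorem exists_extremal_le {n : ℕ} {QA : Matrix (Fin n) (Fin n) ℝ}
    {F : Matrix (Fin n) (Fin n) ℝ → EReal}
    (hF : ∀ Q ∈ classQ QA, ∀ i j₁ j₂ : Fin n, j₁ ≠ j₂ → 0 < QA i j₁ → 0 < QA i j₂ →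
      ConvexOnEReal (Set.Icc 0 (Q i j₁ + Q i j₂)) (fun x => F (exchange Q i j₁ j₂ x)))
    {Q : Matrix (Fin n) (Fin n) ℝ} (hQ : Q ∈ classQ QA) :
    ∃ Qs ∈ classQ QA,
      (∀ i, {j | Qs i j ≠ 0 ∧ Qs i j ≠ rowMax QA i / (n : ℝ)}.Subsingleton) ∧ F Q ≤ F Qs := by
  induction hm : #(fractional QA Q) using Nat.strong_induction_on generalizing Q with
  | _ m ih =>
  by_cases hsub : ∀ i, {j | Q i j ≠ 0 ∧ Q i j ≠ rowMax QA i / (n : ℝ)}.Subsingleton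
  · exact ⟨Q, hQ, hsub, le_rfl⟩
  push Not at hsub
  obtain ⟨i, j₁, h₁, j₂, h₂, hj⟩ := hsub
  obtain ⟨hnn, hsum, hle, hpos⟩ := mem_classQ_iff.1 hQ
  have hp₁ : 0 < Q i j₁ := (hnn _ _).lt_of_ne' h₁.1
  have hp₂ : 0 < Q i j₂ := (hnn _ _).lt_of_ne' h₂.1
  have hl₁ := hle i j₁
  have hl₂ := hle i j₂
  have step : ∀ x, 0 ≤ x → x ≤ Q i j₁ + Q i j₂ → x ≤ rowMax QA i / (n : ℝ) →
      Q i j₁ + Q i j₂ - x ≤ rowMax QA i / (n : ℝ) →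
      ((x = 0 ∨ x = rowMax QA i / (n : ℝ)) ∨
      (Q i j₁ + Q i j₂ - x = 0 ∨ Q i j₁ + Q i j₂ - x = rowMax QA i / (n : ℝ))) →
      F Q ≤ F (exchange Q i j₁ j₂ x) →
      ∃ Qs ∈ classQ QA, (∀ i, {j | Qs i j ≠ 0 ∧ Qs i j ≠ rowMax QA i / (n : ℝ)}.Subsingleton) ∧
        F Q ≤ F Qs := by
    intro x a1 a2 a3 a4 a5 a6
    obtain ⟨Qs, b1, b2, b3⟩ := ih _
      (hm ▸ card_fractional_exchange_lt hj (mem_fractional.2 h₁) (mem_fractional.2 h₂) a5)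
      (exchange_mem_classQ hQ hj hp₁ hp₂ a1 a2 a3 a4) rfl
    exact ⟨Qs, b1, b2, a6.trans b3⟩
  set ρ := rowMax QA i / (n : ℝ) with hρ
  -- The `x` for which both exchanged entries stay in `[0, ρ]` form the interval with these ends,
  -- and the current entry lies in it. At either end one of the two entries equals `0` or `ρ`, hence
  -- is no longer fractional.
  have hu0 : max 0 (Q i j₁ + Q i j₂ - ρ) ≤ Q i j₁ := max_le hp₁.le (by linarith)
  have hv0 : Q i j₁ ≤ min (Q i j₁ + Q i j₂) ρ := le_min (by linarith) hl₁
  have hu1 : 0 ≤ max 0 (Q i j₁ + Q i j₂ - ρ) := le_max_left _ _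
  have hu2 : Q i j₁ + Q i j₂ - ρ ≤ max 0 (Q i j₁ + Q i j₂ - ρ) := le_max_right _ _
  have hv1 : min (Q i j₁ + Q i j₂) ρ ≤ Q i j₁ + Q i j₂ := min_le_left _ _
  have hv2 : min (Q i j₁ + Q i j₂) ρ ≤ ρ := min_le_right _ _
  have hmax := (hF Q hQ i j₁ j₂ hj (hpos _ _ hp₁) (hpos _ _ hp₂)).le_max
    (u := max 0 (Q i j₁ + Q i j₂ - ρ)) (v := min (Q i j₁ + Q i j₂) ρ)
    ⟨hu1, by linarith⟩ ⟨by linarith, hv1⟩ hu0 hv0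
  simp only [exchange_self] at hmax
  rcases le_max_iff.1 hmax with h | h
  · refine step _ hu1 (by linarith) (by linarith) (by linarith) ?_ h
    rcases max_choice 0 (Q i j₁ + Q i j₂ - ρ) with e | e <;> rw [e]
    · exact Or.inl (Or.inl rfl)
    · exact Or.inr (Or.inr (by ring))
  · refine step _ (by linarith) hv1 hv2 (by linarith) ?_ h
    rcases min_choice (Q i j₁ + Q i j₂) ρ with e | e <;> rw [e]
    · exact Or.inr (Or.inl (by ring))
    · exact Or.inl (Or.inr rfl)

/-! ### The main theorem -/

theorem rowMax_div {n : ℕ} (hn : 0 < n) (QA : Matrix (Fin n) (Fin n) ℝ) (i : Fin n) :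
    rowMax QA i / (n : ℝ) = ⨆ j, QA i j := by
  rw [rowMax, mul_div_cancel_left₀]
  exact_mod_cast hn.ne'

theorem scaling_mem_classQ {n : ℕ} (hn : 0 < n) {E : Fin n → Fin n → Prop}
    {QA : Matrix (Fin n) (Fin n) ℝ} (h : IsScaling (adjMatrix E) QA) : QA ∈ classQ QA := by
  refine mem_classQ_iff.2 ⟨fun i j => nonneg_of_mem_doublyStochastic h.1,
    sum_row_of_mem_doublyStochastic h.1, fun i j => ?_, fun _ _ => id⟩
  rw [rowMax_div hn]
  exact le_ciSup (f := fun j => QA i j) (Set.finite_range _).bddAbove j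

/-- Averages of `1 / r` over long initial segments are eventually small. -/
theorem exists_forall_sum_inv_div_le {ε : ℝ} (hε : 0 < ε) :
    ∃ m₀ : ℕ, ∀ m : ℕ, m₀ ≤ m → (∑ r ∈ range m, (r : ℝ)⁻¹) / m ≤ ε := by
  have h := (tendsto_inv_atTop_nhds_zero_nat (𝕜 := ℝ)).cesaro
  obtain ⟨m₀, hm₀⟩ := Filter.eventually_atTop.1 (h.eventually (gt_mem_nhds hε))
  refine ⟨m₀, fun m hm => ?_⟩
  rw [div_eq_inv_mul]
  exact (hm₀ m hm).le

theorem convexOnEReal_upperBound_marginal {n : ℕ} (hn : 0 < n) {lam : ℝ} (hlam : 0 < lam)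
    (hlam' : lam < 1 / 2) (hn6 : 6 ≤ lam * n)
    (hces : ∀ m : ℕ, lam * n / 2 ≤ m → (∑ r ∈ range m, (r : ℝ)⁻¹) / m ≤ lam ^ 4 / 32)
    {E : Fin n → Fin n → Prop} (hE : IsDense lam E) {QA : Matrix (Fin n) (Fin n) ℝ}
    (hQA : IsScaling (adjMatrix E) QA) {Q : Matrix (Fin n) (Fin n) ℝ} (hQ : Q ∈ classQ QA)
    {i j₁ j₂ : Fin n} (hj : j₁ ≠ j₂) (h₁ : E i j₁) (h₂ : E i j₂) :
    ConvexOnEReal (Set.Icc 0 (Q i j₁ + Q i j₂))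
      (fun x => upperBound (marginal E) (exchange Q i j₁ j₂ x)) := by
  have hn0 : (0 : ℝ) < n := by exact_mod_cast hn
  obtain ⟨hnn, hsum, hle, -⟩ := mem_classQ_iff.1 hQ
  have hne := perfectMatchings_nonempty hQA
  have hP₁ := lam_div_le_marginal hlam hlam' (by linarith) hE hne h₁
  have hP₂ := lam_div_le_marginal hlam hlam' (by linarith) hE hne h₂
  have hP0 : 0 < lam / (2 * n) := by positivity
  refine convexOnEReal_upperBound_exchange hj (hP0.trans_le hP₁).ne' (hP0.trans_le hP₂).ne'
    (convexOn_exchange ?_)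
  -- If both entries vanish, the open interval is empty and convexity is vacuous.
  rcases (add_nonneg (hnn i j₁) (hnn i j₂)).eq_or_lt with hs | hs
  · rw [← hs, Set.Ioo_self]
    exact ⟨convex_empty, fun x hx => hx.elim⟩
  have hle' : ∀ j, Q i j ≤ 1 / (2 * lam * n) := by
    intro j
    refine (hle i j).trans ?_
    rw [rowMax_div hn]
    have : Nonempty (Fin n) := ⟨i⟩
    refine ciSup_le fun k => ?_
    rw [le_div_iff₀ (by positivity)]
    exact scaling_apply_mul_le_one hE hQA i k
  have hs' : Q i j₁ + Q i j₂ ≤ 1 / (lam * n) := by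
    have h3 : 1 / (lam * n) = 1 / (2 * lam * n) + 1 / (2 * lam * n) := by field_simp; norm_num
    rw [h3]
    exact add_le_add (hle' j₁) (hle' j₂)
  exact convexOn_row_exchange hj (hnn i) (marginal_nonneg E i)
    (sum_mul_tailWeight_le hn hlam hlam' hn6 hces (hnn i) (hsum i) hle' hs hs'
      (marginal_nonneg E i) (sum_marginal hne i) hj hP₁)
    (sum_mul_tailWeight_le hn hlam hlam' hn6 hces (hnn i) (hsum i) hle' hs hs'
      (marginal_nonneg E i) (sum_marginal hne i) hj.symm hP₂)

end SIS

theorem mainTheorem4 (lam : ℝ) (hlam : 0 < lam) (hlam' : lam < 1 / 2) :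
    ∃ N : ℕ, ∀ n : ℕ, N ≤ n → ∀ E : Fin n → Fin n → Prop, SIS.IsDense lam E →
      ∀ QA : Matrix (Fin n) (Fin n) ℝ, SIS.IsScaling (SIS.adjMatrix E) QA →
        (∃ Qs ∈ SIS.classQ QA,
          (∀ i, {j | Qs i j ≠ 0 ∧ Qs i j ≠ SIS.rowMax QA i / (n : ℝ)}.Subsingleton) ∧
          (SIS.expectedNegLog E QA : EReal) ≤ SIS.upperBound (SIS.marginal E) Qs) ∧
        (∀ Q ∈ SIS.classQ QA, ∀ i j₁ j₂ : Fin n, j₁ ≠ j₂ → E i j₁ → E i j₂ →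
          SIS.ConvexOnEReal (Set.Icc 0 (Q i j₁ + Q i j₂))
            (fun x => SIS.upperBound (SIS.marginal E) (SIS.exchange Q i j₁ j₂ x))) := by
  obtain ⟨m₀, hm₀⟩ := SIS.exists_forall_sum_inv_div_le (ε := lam ^ 4 / 32) (by positivity)
  -- The 6 pays for the columns removed from the large entries; `2 * m₀` ensures that `lam * n / 2 ≤
  -- m` implies `m₀ ≤ m`.
  refine ⟨⌈(6 + 2 * m₀) / lam⌉₊, fun n hN E hE QA hQA => ?_⟩
  have hn' : 6 + 2 * (m₀ : ℝ) ≤ lam * n := by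
    have := (Nat.le_ceil _).trans (Nat.cast_le (α := ℝ).2 hN)
    rw [div_le_iff₀ hlam] at this
    linarith
  have hm0 : (0 : ℝ) ≤ m₀ := Nat.cast_nonneg _
  have hn : 0 < n := by
    rcases Nat.eq_zero_or_pos n with rfl | h
    · norm_num at hn'
      linarith
    · exact h
  have hconv : ∀ Q ∈ SIS.classQ QA, ∀ i j₁ j₂ : Fin n, j₁ ≠ j₂ → E i j₁ → E i j₂ →
      SIS.ConvexOnEReal (Set.Icc 0 (Q i j₁ + Q i j₂))
        (fun x => SIS.upperBound (SIS.marginal E) (SIS.exchange Q i j₁ j₂ x)) :=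
    fun Q hQ i j₁ j₂ hj h₁ h₂ => SIS.convexOnEReal_upperBound_marginal hn hlam hlam'
      (by linarith) (fun m hm => hm₀ m (by exact_mod_cast (by linarith : (m₀ : ℝ) ≤ m)))
      hE hQA hQ hj h₁ h₂
  refine ⟨?_, hconv⟩
  obtain ⟨α, β, -, h0⟩ := hQA.apply
  have hedge : ∀ i j, 0 < QA i j → E i j := fun i j h => by
    by_contra hij
    exact h.ne' (h0 i j hij)
  obtain ⟨Qs, h1, h2, h3⟩ := SIS.exists_extremal_le
    (F := fun Q => SIS.upperBound (SIS.marginal E) Q)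
    (fun Q hQ i j₁ j₂ hj h₁ h₂ => hconv Q hQ i j₁ j₂ hj (hedge _ _ h₁) (hedge _ _ h₂))
    (SIS.scaling_mem_classQ hn hQA)
  exact ⟨Qs, h1, h2, (SIS.expectedNegLog_le_upperBound fun i j =>
    nonneg_of_mem_doublyStochastic hQA.1).trans h3⟩
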